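/- Let $\Gamma$ be a polymatrix game: a finite simple undirected graph $(V,E)$ of players with $V\neq\emptyset$, a finite nonempty action set $S_k$ for each $k\in V$, and real payoff matrices $A_{kl}\in\mathbb R^{S_k\times S_l}$, $A_{lk}\in\mathbb R^{S_l\times S_k}$ for each edge $[k,l]\in E$. Let $\Delta_k$ be the simplex of probability vectors on $S_k$ and $\Delta=\prod_{k}\Delta_k$; a profile $x\in\Delta$ is interior if $x_{ki}>0$ for all $k,i$. Put $r_{ki}(x_{-k})=\sum_{l:[k,l]\in E}(A_{kl}x_l)_i$ and $u_k(x)=x_k^\top r_k(x_{-k})$. Assume that $\Gamma$ is a rescaled (weighted) zero-sum game: for given weights $w_k>0$ we have $\sum_{k}w_ku_k(x)=0$ for all $x\in\Delta$. Let $T_k>0$ $(k\in V)$ be exploration rates. A QRE is a profile $p\in\Delta$ with $$p_{ki}=\frac{\exp(r_{ki}(p_{-k})/T_k)}{\sum_{j\in S_k}\exp(r_{kj}(p_{-k})/T_k)}\qquad(k\in V,\ i\in S_k),$$ and the Q-learning dynamics $\dot x=f(x)$ on $\Delta$ are $$\dot x_{ki}=x_{ki}\Big[r_{ki}(x_{-k})-x_k^\top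 r_k(x_{-k})-T_k\big(\ln x_{ki}-\textstyle\sum_{j\in S_k}x_{kj}\ln x_{kj}\big)\Big],$$ with $0\ln 0=0$. Trajectories are solutions $x:[0,\infty)\to\Delta$. Write $D_{\rm KL}(y\|z)=\sum_i y_i\ln(y_i/z_i)$ and $D_{{\rm KL}(w)}(p\|x)=\sum_{k}w_kD_{\rm KL}(p_k\|x_k)$. Theorem. The game $\Gamma$ has a unique QRE $p$, and the following hold. 1. The function $\Phi(x)=D_{{\rm KL}(w)}(p\|x)$ is a strict Lyapunov function for the dynamics on the set of interior profiles: $p$ is an interior profile with $f(p)=0$, $\Phi$ is differentiable at every interior profile, $\Phi(p)=0$, and $\Phi(x)>0$ and $\nabla\Phi(x)\cdot f(x)<0$ for every interior $x\ne p$. 2. Every trajectory with $x(0)$ interior stays interior, and for all $t\ge 0$ (with the one-sided derivative at $t=0$) $$\frac{d}{dt}D_{{\rm KL}(w)}(p\|x(t))=-\sum_{k\in V}w_kT_k\big[D_{\rm KL}(p_k\|x_k(t))+D_{\rm KL}(x_k(t)\|p_k)\big],$$ $$D_{{\rm KL}(w)}(p\|x(t))\le D_{{\rm KL}(w)}(p\|x(0))\,e^{-(\min_kT_k)\,t}.$$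 3. Every trajectory with $x(0)$ interior converges to $p$ exponentially fast: there is $c>0$ such that for every interior $x_0$ there is a constant $C$ with $\max_{k,i}|x_{ki}(t)-p_{ki}|\le Ce^{-ct}$ for all $t\ge0$ and every trajectory with $x(0)=x_0$. -/

import Mathlib

open scoped BigOperators

/-- A polymatrix game with player set `V` and action sets `S k`: an undirected graph on the
players and, for each ordered pair `(k, l)`, a payoff matrix of player `k` against player `l`.
Only the matrices of adjacent pairs are ever used. -/
structure PolymatrixGame (V : Type*) (S : V → Type*) where
  /-- the interaction graph -/
  graph : SimpleGraph V
  /-- the payoff matrices -/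
  A : ∀ k l : V, Matrix (S k) (S l) ℝ

namespace PolymatrixGame

/-- Mixed strategy profiles: one probability vector per player. -/
def mixedProfiles {V : Type*} (S : V → Type*) [∀ k, Fintype (S k)] : Set (∀ k, S k → ℝ) :=
  {x | ∀ k, x k ∈ stdSimplex ℝ (S k)}

/-- Interior mixed strategy profiles: every action has positive probability. -/
def interiorProfiles {V : Type*} (S : V → Type*) [∀ k, Fintype (S k)] : Set (∀ k, S k → ℝ) :=
  {x | x ∈ mixedProfiles S ∧ ∀ k i, 0 < x k i}

section Game

variable {V : Type*} [Fintype V] {S : V → Type*} [∀ k, Fintype (S k)]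

open Classical in
/-- The reward `r_{ki}(x_{-k})` of action `i` of player `k`: the sum of `(A_{kl} x_l)_i` over the
neighbours `l` of `k`. The graph has no loops, so `x k` does not enter. -/
noncomputable def reward (G : PolymatrixGame V S) (x : ∀ k, S k → ℝ) (k : V) (i : S k) : ℝ :=
  ∑ l ∈ Finset.univ.filter (fun l => G.graph.Adj k l), ((G.A k l).mulVec (x l)) i

/-- The expected utility `u_k(x) = x_k ⬝ r_k(x_{-k})` of player `k`. -/
noncomputable def utility (G : PolymatrixGame V S) (x : ∀ k, S k → ℝ) (k : V) : ℝ :=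
  ∑ i, x k i * G.reward x k i

/-- `G` is a rescaled (weighted) zero-sum polymatrix game with the positive weights `w`. -/
def IsRescaledZeroSum (G : PolymatrixGame V S) (w : V → ℝ) : Prop :=
  (∀ k, 0 < w k) ∧ ∀ x ∈ mixedProfiles S, ∑ k, w k * G.utility x k = 0

/-- Quantal response (logit) equilibrium for the exploration rates `T`. -/
def IsQRE (G : PolymatrixGame V S) (T : V → ℝ) (p : ∀ k, S k → ℝ) : Prop :=
  p ∈ mixedProfiles S ∧ ∀ k i,
    p k i = Real.exp (G.reward p k i / T k) / ∑ j, Real.exp (G.reward p k j / T k)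

/-- The vector field of the Q-learning dynamics with exploration rates `T`. -/
noncomputable def qField (G : PolymatrixGame V S) (T : V → ℝ) (x : ∀ k, S k → ℝ) :
    ∀ k, S k → ℝ :=
  fun k i => x k i * (G.reward x k i - ∑ j, x k j * G.reward x k j
    - T k * (Real.log (x k i) - ∑ j, x k j * Real.log (x k j)))

/-- `x` (restricted to times `t ≥ 0`) is a trajectory of the Q-learning dynamics: it moves in the
space of mixed profiles and solves the differential equation, with the one-sided derivative at
time `0`. -/
def IsQTrajectory (G : PolymatrixGame V S) (T : V → ℝ) (x : ℝ → ∀ k, S k → ℝ) : Prop :=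
  ∀ t, 0 ≤ t → x t ∈ mixedProfiles S ∧ HasDerivWithinAt x (G.qField T (x t)) (Set.Ici 0) t

end Game

end PolymatrixGame

/-- Kullback-Leibler divergence `∑ p_i ln (p_i / q_i)`, for vectors `q` with positive entries. -/
noncomputable def klVec {ι : Type*} [Fintype ι] (p q : ι → ℝ) : ℝ :=
  ∑ i, p i * Real.log (p i / q i)

/-- Weighted Kullback-Leibler divergence `∑ k, w_k D_KL(p_k ‖ x_k)` of profiles. -/
noncomputable def klWeighted {V : Type*} [Fintype V] {S : V → Type*} [∀ k, Fintype (S k)]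
    (w : V → ℝ) (p x : ∀ k, S k → ℝ) : ℝ :=
  ∑ k, w k * klVec (p k) (x k)

/-- `Φ` is a strict Lyapunov function on `U` for the vector field `f` and its rest point `p`: it
vanishes at `p`, is positive on the rest of `U`, and its orbital derivative `∇Φ(x) ⬝ f(x)` is
negative on the rest of `U`. -/
structure IsStrictLyapunov {E : Type*} [NormedAddCommGroup E] [NormedSpace ℝ E]
    (U : Set E) (f : E → E) (p : E) (Φ : E → ℝ) : Prop where
  mem : p ∈ U
  rest : f p = 0
  zero : Φ p = 0
  pos : ∀ x ∈ U, x ≠ p → 0 < Φ x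
  diff : ∀ x ∈ U, DifferentiableAt ℝ Φ x
  neg : ∀ x ∈ U, x ≠ p → fderiv ℝ Φ x (f x) < 0

/-!
Write `B(y, x) = ∑ k, w_k y_k ⬝ r_k(x)` for the weighted payoff and `N` for the weighted negative
entropy `∑ k, w_k T_k ∑ i, x_{ki} ln x_{ki}`. The form `B` is bilinear and vanishes on the diagonal
of the mixed profiles, so it is skew-symmetric there (`IsRescaledZeroSum.weightedPayoff_skew`).

Existence of an equilibrium needs no fixed point theorem. Let `σ(x)` be the logit response to `x`;
by Gibbs' principle it maximises `B(·, x) - N`. The gap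
`g(x) = B(σ(x), x) - N(σ(x)) + N(x)` is continuous and convex, and attains its minimum on the
compact set of mixed profiles. At `x` with `y = σ(x)`, skew-symmetry turns the slope of `g` in
direction `y - x` into `-∑ k, w_k T_k ∑ i, (y_{ki} - x_{ki}) (ln y_{ki} - ln x_{ki})`, which is
negative unless `y = x`; so a minimiser is an equilibrium (`logitResponse_eq_of_isMinOn`). A
minimiser might lie on the boundary, where this slope is `-∞`, hence slopes are only taken at
points `x + s (y - x)` with `s > 0`, and bounded uniformly as `s → 0`.

At an equilibrium `p`, `r_{ki}(p) - T_k ln p_{ki}` does not depend on `i`. Subtracting this from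
the orbital derivative of `D_{KL(w)}(p ‖ ·)` leaves the payoff term `B(x - p, x - p) = 0` and minus
the weighted symmetrised divergence (`IsQRE.sum_qField_div`). This identity gives the Lyapunov
property and uniqueness (a second equilibrium would be a rest point without dissipation), and,
integrated along trajectories, the exponential decay of the divergence. A Pinsker-type bound
(`sum_sq_le_klVec`) converts the decay into convergence in norm. Trajectories stay interior
because each coordinate satisfies a linear differential inequality `u' ≥ -M u`.
-/

namespace PolymatrixGame

/-! ### Divergence of probability vectors -/

/-- A termwise Pinsker-type bound for the divergence. -/
theorem sub_add_sq_le_mul_log_div {a b : ℝ} (ha : 0 ≤ a) (ha1 : a ≤ 1) (hb : 0 < b)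
    (hb1 : b ≤ 1) : a - b + (a - b) ^ 2 / 4 ≤ a * Real.log (a / b) := by
  have hsb : 0 < √b := Real.sqrt_pos.2 hb
  have hb2 : √b ^ 2 = b := Real.sq_sqrt hb.le
  have ha2 : √a ^ 2 = a := Real.sq_sqrt ha
  have hsa1 : √a ≤ 1 := Real.sqrt_le_one.2 ha1
  have hsb1 : √b ≤ 1 := Real.sqrt_le_one.2 hb1
  have hsa : 0 ≤ √a := Real.sqrt_nonneg a
  -- the Hellinger bound `a log (a / b) ≥ 2 a - 2 √(a b)`
  have h1 : 2 * √a ^ 2 - 2 * (√a * √b) ≤ a * Real.log (a / b) := by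
    rcases ha.eq_or_lt with rfl | ha0
    · simp
    have hsa0 : 0 < √a := Real.sqrt_pos.2 ha0
    have h2 : Real.log (a / b) = -(2 * Real.log (√b / √a)) := by
      rw [← hb2, ← ha2, ← div_pow, Real.log_pow, Real.sqrt_sq hsa, Real.sqrt_sq hsb.le,
        ← inv_div, Real.log_inv]
      push_cast
      ring
    have h3 := Real.log_le_sub_one_of_pos (div_pos hsb hsa0)
    have h4 : √a ^ 2 * (√b / √a) = √a * √b := by field_simp
    rw [h2, ← ha2, Real.sqrt_sq hsa]
    nlinarith [mul_le_mul_of_nonneg_left h3 (sq_nonneg √a)]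
  have h5 : (√a ^ 2 - √b ^ 2) ^ 2 ≤ 4 * (√a - √b) ^ 2 := by
    have : (√a ^ 2 - √b ^ 2) ^ 2 = (√a + √b) ^ 2 * (√a - √b) ^ 2 := by ring
    rw [this]
    apply mul_le_mul_of_nonneg_right _ (sq_nonneg _)
    nlinarith
  nlinarith

theorem sub_add_sq_le_mul_log_sub {a b : ℝ} (ha : 0 ≤ a) (ha1 : a ≤ 1) (hb : 0 < b)
    (hb1 : b ≤ 1) :
    a - b + (a - b) ^ 2 / 4 ≤ a * Real.log a - a * Real.log b := by
  refine (sub_add_sq_le_mul_log_div ha ha1 hb hb1).trans_eq ?_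
  rcases ha.eq_or_lt with rfl | ha0
  · simp
  · rw [Real.log_div ha0.ne' hb.ne', mul_sub]

section KL

variable {ι : Type*} [Fintype ι]

theorem le_one_of_mem_stdSimplex {p : ι → ℝ} (hp : p ∈ stdSimplex ℝ ι) (i : ι) : p i ≤ 1 :=
  (mem_Icc_of_mem_stdSimplex hp i).2

/-- A Pinsker-type bound: the divergence controls the squared distance. -/
theorem sum_sq_le_klVec {p q : ι → ℝ} (hp : p ∈ stdSimplex ℝ ι) (hq : q ∈ stdSimplex ℝ ι)
    (hq0 : ∀ i, 0 < q i) : ∑ i, (p i - q i) ^ 2 / 4 ≤ klVec p q := by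
  have h : ∑ i, (p i - q i + (p i - q i) ^ 2 / 4) ≤ klVec p q :=
    Finset.sum_le_sum fun i _ => sub_add_sq_le_mul_log_div (hp.1 i)
      (le_one_of_mem_stdSimplex hp i) (hq0 i) (le_one_of_mem_stdSimplex hq i)
  rwa [Finset.sum_add_distrib, Finset.sum_sub_distrib, hp.2, hq.2, sub_self, zero_add] at h

theorem sq_le_klVec {p q : ι → ℝ} (hp : p ∈ stdSimplex ℝ ι) (hq : q ∈ stdSimplex ℝ ι)
    (hq0 : ∀ i, 0 < q i) (i : ι) : (p i - q i) ^ 2 / 4 ≤ klVec p q :=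
  (Finset.single_le_sum (f := fun i => (p i - q i) ^ 2 / 4) (fun _ _ => by positivity)
    (Finset.mem_univ i)).trans (sum_sq_le_klVec hp hq hq0)

theorem klVec_nonneg {p q : ι → ℝ} (hp : p ∈ stdSimplex ℝ ι) (hq : q ∈ stdSimplex ℝ ι)
    (hq0 : ∀ i, 0 < q i) : 0 ≤ klVec p q :=
  (Finset.sum_nonneg fun _ _ => by positivity).trans (sum_sq_le_klVec hp hq hq0)

theorem klVec_pos {p q : ι → ℝ} (hp : p ∈ stdSimplex ℝ ι) (hq : q ∈ stdSimplex ℝ ι)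
    (hq0 : ∀ i, 0 < q i) (hne : p ≠ q) : 0 < klVec p q := by
  obtain ⟨i, hi⟩ := Function.ne_iff.1 hne
  have := sub_ne_zero.2 hi
  exact lt_of_lt_of_le (by positivity) (sq_le_klVec hp hq hq0 i)

theorem klVec_self {p : ι → ℝ} (hp0 : ∀ i, 0 < p i) : klVec p p = 0 :=
  Finset.sum_eq_zero fun i _ => by rw [div_self (hp0 i).ne', Real.log_one, mul_zero]

theorem klVec_add_klVec_symm {p q : ι → ℝ} (hp0 : ∀ i, 0 < p i) (hq0 : ∀ i, 0 < q i) :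
    klVec p q + klVec q p = ∑ i, (p i - q i) * (Real.log (p i) - Real.log (q i)) := by
  simp only [klVec, ← Finset.sum_add_distrib]
  refine Finset.sum_congr rfl fun i _ => ?_
  rw [Real.log_div (hp0 i).ne' (hq0 i).ne', Real.log_div (hq0 i).ne' (hp0 i).ne']
  ring

end KL

/-! ### Mixed profiles and payoffs -/

section Game

variable {V : Type*} {S : V → Type*} [∀ k, Fintype (S k)]

theorem isCompact_mixedProfiles : IsCompact (mixedProfiles S) := by
  have : mixedProfiles S = Set.univ.pi fun k => stdSimplex ℝ (S k) := by
    ext x; simp [mixedProfiles]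
  rw [this]
  exact isCompact_univ_pi fun k => isCompact_stdSimplex ℝ (S k)

theorem convex_mixedProfiles : Convex ℝ (mixedProfiles S) :=
  fun _ hx _ hy _ _ ha hb hab k => convex_stdSimplex ℝ (S k) (hx k) (hy k) ha hb hab

theorem nonempty_mixedProfiles [∀ k, Nonempty (S k)] : (mixedProfiles S).Nonempty := by
  classical
  exact ⟨fun k => Pi.single (Classical.arbitrary (S k)) 1,
    fun k => single_mem_stdSimplex ℝ (Classical.arbitrary (S k))⟩

variable [Fintype V] (G : PolymatrixGame V S)

theorem reward_add (x y : ∀ k, S k → ℝ) (k : V) (i : S k) :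
    G.reward (x + y) k i = G.reward x k i + G.reward y k i := by
  simp [reward, Matrix.mulVec_add, Finset.sum_add_distrib]

theorem reward_smul (c : ℝ) (x : ∀ k, S k → ℝ) (k : V) (i : S k) :
    G.reward (c • x) k i = c * G.reward x k i := by
  simp [reward, Matrix.mulVec_smul, Finset.mul_sum]

@[fun_prop]
theorem continuous_reward (k : V) (i : S k) : Continuous fun x => G.reward x k i := by
  unfold reward Matrix.mulVec dotProduct
  fun_prop

/-- The weighted payoff `B(y, x) = ∑ k, w_k y_k ⬝ r_k(x)`, in which every player `k` plays `y_k`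
while her opponents play according to `x`. -/
noncomputable def weightedPayoff (w : V → ℝ) (y x : ∀ k, S k → ℝ) : ℝ :=
  ∑ k, w k * ∑ i, y k i * G.reward x k i

theorem weightedPayoff_add_left (w : V → ℝ) (y z x : ∀ k, S k → ℝ) :
    G.weightedPayoff w (y + z) x = G.weightedPayoff w y x + G.weightedPayoff w z x := by
  simp [weightedPayoff, add_mul, mul_add, Finset.sum_add_distrib]

theorem weightedPayoff_smul_left (w : V → ℝ) (c : ℝ) (y x : ∀ k, S k → ℝ) :
    G.weightedPayoff w (c • y) x = c * G.weightedPayoff w y x := by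
  simp [weightedPayoff, Finset.mul_sum, mul_assoc, mul_left_comm]

theorem weightedPayoff_add_right (w : V → ℝ) (y x z : ∀ k, S k → ℝ) :
    G.weightedPayoff w y (x + z) = G.weightedPayoff w y x + G.weightedPayoff w y z := by
  simp [weightedPayoff, reward_add, mul_add, Finset.sum_add_distrib]

theorem weightedPayoff_smul_right (w : V → ℝ) (c : ℝ) (y x : ∀ k, S k → ℝ) :
    G.weightedPayoff w y (c • x) = c * G.weightedPayoff w y x := by
  simp [weightedPayoff, reward_smul, Finset.mul_sum, mul_left_comm]

/-- The weighted negative entropy `N(x) = ∑ k, w_k T_k ∑ i, x_{ki} ln x_{ki}`. -/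
noncomputable def weightedNegEntropy (w T : V → ℝ) (x : ∀ k, S k → ℝ) : ℝ :=
  ∑ k, w k * (T k * ∑ i, x k i * Real.log (x k i))

theorem continuous_weightedNegEntropy (w T : V → ℝ) :
    Continuous fun x : ∀ k, S k → ℝ => weightedNegEntropy w T x := by
  unfold weightedNegEntropy
  refine continuous_finsetSum _ fun k _ => continuous_const.mul (continuous_const.mul
    (continuous_finsetSum _ fun i _ => ?_))
  exact Real.continuous_mul_log.comp (by fun_prop : Continuous fun x : ∀ k, S k → ℝ => x k i)

/-- The logit (soft-max) response of the players to the profile `x`. -/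
noncomputable def logitResponse (T : V → ℝ) (x : ∀ k, S k → ℝ) : ∀ k, S k → ℝ :=
  fun k i => Real.exp (G.reward x k i / T k) / ∑ j, Real.exp (G.reward x k j / T k)

variable {G} {w T : V → ℝ}

theorem IsRescaledZeroSum.weightedPayoff_self (hG : G.IsRescaledZeroSum w)
    {x : ∀ k, S k → ℝ} (hx : x ∈ mixedProfiles S) : G.weightedPayoff w x x = 0 := hG.2 x hx

/-- On mixed profiles the weighted payoff of a rescaled zero-sum game is skew-symmetric. -/
theorem IsRescaledZeroSum.weightedPayoff_skew (hG : G.IsRescaledZeroSum w)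
    {x y : ∀ k, S k → ℝ} (hx : x ∈ mixedProfiles S) (hy : y ∈ mixedProfiles S) :
    G.weightedPayoff w x y = -G.weightedPayoff w y x := by
  -- the diagonal vanishes at `x`, at `y` and at their midpoint
  have h := hG.weightedPayoff_self (convex_mixedProfiles hx hy
    (by norm_num : (0 : ℝ) ≤ 1 / 2) (by norm_num : (0 : ℝ) ≤ 1 / 2) (by norm_num))
  simp only [weightedPayoff_add_left, weightedPayoff_add_right, weightedPayoff_smul_left,
    weightedPayoff_smul_right, hG.weightedPayoff_self hx, hG.weightedPayoff_self hy] at h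
  linarith

/-! ### The logit response and Gibbs' principle -/

variable (G) in
theorem sum_exp_reward_pos [∀ k, Nonempty (S k)] (T : V → ℝ) (x : ∀ k, S k → ℝ) (k : V) :
    0 < ∑ j, Real.exp (G.reward x k j / T k) :=
  Finset.sum_pos (fun _ _ => Real.exp_pos _) Finset.univ_nonempty

variable (G) in
theorem logitResponse_mem [∀ k, Nonempty (S k)] (T : V → ℝ) (x : ∀ k, S k → ℝ) :
    G.logitResponse T x ∈ interiorProfiles S := by
  have h k i : 0 < G.logitResponse T x k i :=
    div_pos (Real.exp_pos _) (G.sum_exp_reward_pos T x k)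
  refine ⟨fun k => ⟨fun i => (h k i).le, ?_⟩, h⟩
  simp only [logitResponse, ← Finset.sum_div]
  exact div_self (G.sum_exp_reward_pos T x k).ne'

variable (G) in
theorem continuous_logitResponse [∀ k, Nonempty (S k)] (T : V → ℝ) :
    Continuous fun x => G.logitResponse T x := by
  unfold logitResponse
  refine continuous_pi fun k => continuous_pi fun i => ?_
  refine Continuous.div (by fun_prop) (by fun_prop) fun x => (G.sum_exp_reward_pos T x k).ne'

theorem mul_log_logitResponse [∀ k, Nonempty (S k)] (hT : ∀ k, 0 < T k) (x : ∀ k, S k → ℝ)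
    (k : V) (i : S k) :
    T k * Real.log (G.logitResponse T x k i) =
      G.reward x k i - T k * Real.log (∑ j, Real.exp (G.reward x k j / T k)) := by
  rw [logitResponse, Real.log_div (Real.exp_pos _).ne' (G.sum_exp_reward_pos T x k).ne',
    Real.log_exp, mul_sub, mul_div_cancel₀ _ (hT k).ne']

/-- Against a difference of mixed strategies, whose entries sum to `0`, rewards and rescaled
logarithms of the logit response agree. -/
theorem sum_mul_log_logitResponse [∀ k, Nonempty (S k)] (hT : ∀ k, 0 < T k)
    (x : ∀ k, S k → ℝ) (k : V) {y z : S k → ℝ} (hy : y ∈ stdSimplex ℝ (S k))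
    (hz : z ∈ stdSimplex ℝ (S k)) :
    T k * ∑ i, (y i - z i) * Real.log (G.logitResponse T x k i) =
      ∑ i, (y i - z i) * G.reward x k i := by
  have h : ∑ i, (y i - z i) = 0 := by rw [Finset.sum_sub_distrib, hy.2, hz.2, sub_self]
  rw [Finset.mul_sum]
  calc _ = ∑ i, ((y i - z i) * G.reward x k i
        - (y i - z i) * (T k * Real.log (∑ j, Real.exp (G.reward x k j / T k)))) :=
        Finset.sum_congr rfl fun i _ => by
          rw [mul_left_comm, mul_log_logitResponse hT, mul_sub]
    _ = _ := by rw [Finset.sum_sub_distrib, ← Finset.sum_mul, h, zero_mul, sub_zero]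

theorem weightedPayoff_sub_eq [∀ k, Nonempty (S k)] (hT : ∀ k, 0 < T k)
    (x : ∀ k, S k → ℝ) {y z : ∀ k, S k → ℝ} (hy : y ∈ mixedProfiles S)
    (hz : z ∈ mixedProfiles S) :
    G.weightedPayoff w y x - G.weightedPayoff w z x =
      ∑ k, w k * (T k * ∑ i, (y k i - z k i) * Real.log (G.logitResponse T x k i)) := by
  simp only [weightedPayoff, ← Finset.sum_sub_distrib, ← mul_sub, ← sub_mul]
  exact Finset.sum_congr rfl fun k _ => by rw [sum_mul_log_logitResponse hT x k (hy k) (hz k)]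

/-- The tangent inequality of the convex function `N`. -/
theorem weightedNegEntropy_sub_le (hw : ∀ k, 0 < w k) (hT : ∀ k, 0 < T k)
    {y z : ∀ k, S k → ℝ} (hy : y ∈ mixedProfiles S) (hz : z ∈ interiorProfiles S) :
    weightedNegEntropy w T z - weightedNegEntropy w T y ≤
      ∑ k, w k * (T k * ∑ i, (z k i - y k i) * Real.log (z k i)) := by
  simp only [weightedNegEntropy, ← Finset.sum_sub_distrib, ← mul_sub]
  refine Finset.sum_le_sum fun k _ => mul_le_mul_of_nonneg_left
    (mul_le_mul_of_nonneg_left ?_ (hT k).le) (hw k).le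
  have h0 : ∑ i, (y k i - z k i) = 0 := by
    rw [Finset.sum_sub_distrib, (hy k).2, (hz.1 k).2, sub_self]
  rw [← sub_nonneg, ← Finset.sum_sub_distrib, ← h0]
  refine Finset.sum_le_sum fun i _ => ?_
  have := sub_add_sq_le_mul_log_sub ((hy k).1 i) (le_one_of_mem_stdSimplex (hy k) i) (hz.2 k i)
    (le_one_of_mem_stdSimplex (hz.1 k) i)
  nlinarith [sq_nonneg (y k i - z k i)]

/-- Gibbs' variational principle: the logit response to `x` maximises the weighted payoff
against `x`, regularised by the weighted entropy. -/
theorem weightedPayoff_sub_negEntropy_le [∀ k, Nonempty (S k)] (hw : ∀ k, 0 < w k)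
    (hT : ∀ k, 0 < T k) (x : ∀ k, S k → ℝ) {y : ∀ k, S k → ℝ} (hy : y ∈ mixedProfiles S) :
    G.weightedPayoff w y x - weightedNegEntropy w T y ≤
      G.weightedPayoff w (G.logitResponse T x) x
        - weightedNegEntropy w T (G.logitResponse T x) := by
  have h1 := weightedNegEntropy_sub_le hw hT hy (G.logitResponse_mem T x)
  have h2 := weightedPayoff_sub_eq (G := G) (w := w) hT x (G.logitResponse_mem T x).1 hy
  linarith

/-! ### Existence of a quantal response equilibrium -/

variable (G) in
/-- The total weighted regret, in the entropy-regularised game, of not playing the logit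
response. It is nonnegative in a rescaled zero-sum game, and vanishes exactly at the quantal
response equilibria. -/
noncomputable def logitGap (w T : V → ℝ) (x : ∀ k, S k → ℝ) : ℝ :=
  G.weightedPayoff w (G.logitResponse T x) x - weightedNegEntropy w T (G.logitResponse T x)
    + weightedNegEntropy w T x

theorem continuous_weightedPayoff {X : Type*} [TopologicalSpace X] (w : V → ℝ)
    {f g : X → ∀ k, S k → ℝ} (hf : Continuous f) (hg : Continuous g) :
    Continuous fun s => G.weightedPayoff w (f s) (g s) := by
  unfold weightedPayoff
  refine continuous_finsetSum _ fun k _ => continuous_const.mul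
    (continuous_finsetSum _ fun i _ => ?_)
  exact ((continuous_apply i).comp ((continuous_apply k).comp hf)).mul
    ((G.continuous_reward k i).comp hg)

theorem continuous_logitGap [∀ k, Nonempty (S k)] (w T : V → ℝ) :
    Continuous (G.logitGap w T) := by
  have h := G.continuous_logitResponse T
  exact ((continuous_weightedPayoff w h continuous_id).sub
    ((continuous_weightedNegEntropy w T).comp h)).add (continuous_weightedNegEntropy w T)

/-- Moving from `x` a fraction `s` towards a profile `y` changes the gap by at most `s` times its
slope at the new profile: the gap is convex. -/
theorem logitGap_segment_le [∀ k, Nonempty (S k)] (hw : ∀ k, 0 < w k) (hT : ∀ k, 0 < T k)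
    {x y : ∀ k, S k → ℝ} (hx : x ∈ mixedProfiles S) {s : ℝ}
    (hs : x + s • (y - x) ∈ interiorProfiles S) :
    G.logitGap w T (x + s • (y - x)) - G.logitGap w T x ≤
      s * (G.weightedPayoff w (G.logitResponse T (x + s • (y - x))) (y - x)
        + ∑ k, w k * (T k * ∑ i, (y k i - x k i) * Real.log ((x + s • (y - x)) k i))) := by
  have h1 := weightedPayoff_sub_negEntropy_le (G := G) hw hT x
    (G.logitResponse_mem T (x + s • (y - x))).1
  have h2 := weightedNegEntropy_sub_le hw hT hx hs
  have h3 : ∑ k, w k * (T k * ∑ i, ((x + s • (y - x)) k i - x k i)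
        * Real.log ((x + s • (y - x)) k i)) =
      s * ∑ k, w k * (T k * ∑ i, (y k i - x k i) * Real.log ((x + s • (y - x)) k i)) := by
    simp only [Finset.mul_sum]
    refine Finset.sum_congr rfl fun k _ => Finset.sum_congr rfl fun i _ => ?_
    simp only [Pi.add_apply, Pi.smul_apply, Pi.sub_apply, smul_eq_mul]
    ring
  have h4 := G.weightedPayoff_add_right w (G.logitResponse T (x + s • (y - x))) x (s • (y - x))
  rw [weightedPayoff_smul_right] at h4
  rw [h3] at h2
  unfold logitGap
  linarith

/-- The contribution of one action to the slope of the entropy is bounded, uniformly on the first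
half of the segment from `a` to `b`, by its value at the midpoint. This replaces the value at `a`,
which is `-∞` for `a = 0`. -/
theorem sub_mul_log_segment_le {a b s : ℝ} (ha : 0 ≤ a) (hb : 0 < b) (hs : 0 < s)
    (hs1 : s ≤ 1 / 2) :
    (b - a) * (Real.log (a + s * (b - a)) - Real.log b) ≤
      (b - a) * (Real.log (a + 1 / 2 * (b - a)) - Real.log b) := by
  have h1 : 0 < a + s * (b - a) := by nlinarith
  have h2 : 0 < a + 1 / 2 * (b - a) := by linarith
  rcases le_total a b with h | h
  · have := Real.log_le_log h1 (by nlinarith : a + s * (b - a) ≤ a + 1 / 2 * (b - a))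
    nlinarith
  · have := Real.log_le_log h2 (by nlinarith : a + 1 / 2 * (b - a) ≤ a + s * (b - a))
    nlinarith

theorem sub_mul_log_midpoint_neg {a b : ℝ} (ha : 0 ≤ a) (hb : 0 < b) (hab : a ≠ b) :
    (b - a) * (Real.log (a + 1 / 2 * (b - a)) - Real.log b) < 0 := by
  have h2 : 0 < a + 1 / 2 * (b - a) := by linarith
  rcases lt_or_gt_of_ne hab with h | h
  · have := Real.log_lt_log h2 (by linarith : a + 1 / 2 * (b - a) < b)
    nlinarith
  · have := Real.log_lt_log hb (by linarith : b < a + 1 / 2 * (b - a))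
    nlinarith

/-- A minimiser of the gap is its own logit response: otherwise a small step towards the logit
response would lower the gap. -/
theorem logitResponse_eq_of_isMinOn [∀ k, Nonempty (S k)] (hG : G.IsRescaledZeroSum w)
    (hT : ∀ k, 0 < T k) {x : ∀ k, S k → ℝ} (hx : x ∈ mixedProfiles S)
    (hmin : IsMinOn (G.logitGap w T) (mixedProfiles S) x) : G.logitResponse T x = x := by
  by_contra hne
  set y := G.logitResponse T x with hydef
  have hy := G.logitResponse_mem T x
  rw [← hydef] at hy
  -- `m` bounds the entropy part of the slope of the gap at `x + s (y - x)`, relative to that of `y`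
  let m : ℝ := ∑ k, w k * (T k * ∑ i, (y k i - x k i) *
    (Real.log (x k i + 1 / 2 * (y k i - x k i)) - Real.log (y k i)))
  have hterm k i : (y k i - x k i) *
      (Real.log (x k i + 1 / 2 * (y k i - x k i)) - Real.log (y k i)) ≤ 0 := by
    rcases eq_or_ne (x k i) (y k i) with h | h
    · simp [h]
    · exact (sub_mul_log_midpoint_neg ((hx k).1 i) (hy.2 k i) h).le
  have hm : m < 0 := by
    obtain ⟨k, hk⟩ := Function.ne_iff.1 hne
    obtain ⟨i, hi⟩ := Function.ne_iff.1 hk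
    refine Finset.sum_neg' (fun k _ => ?_) ⟨k, Finset.mem_univ k, ?_⟩
    · exact mul_nonpos_of_nonneg_of_nonpos (hG.1 k).le (mul_nonpos_of_nonneg_of_nonpos (hT k).le
        (Finset.sum_nonpos fun i _ => hterm k i))
    · exact mul_neg_of_pos_of_neg (hG.1 k) (mul_neg_of_pos_of_neg (hT k)
        (Finset.sum_neg' (fun i _ => hterm k i) ⟨i, Finset.mem_univ i,
          sub_mul_log_midpoint_neg ((hx k).1 i) (hy.2 k i) (Ne.symm hi)⟩))
  -- `φ s` bounds the whole slope for `0 < s ≤ 1 / 2`; it is continuous also at `s = 0`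
  let φ : ℝ → ℝ := fun s => G.weightedPayoff w (G.logitResponse T (x + s • (y - x))) (y - x)
    - G.weightedPayoff w y (y - x) + m
  have hφ : Continuous φ := by
    have : Continuous fun s : ℝ => x + s • (y - x) := by fun_prop
    exact ((continuous_weightedPayoff w ((G.continuous_logitResponse T).comp this)
      continuous_const).sub continuous_const).add continuous_const
  have hφ0 : φ 0 < 0 := by
    simp only [φ, zero_smul, add_zero, ← hydef, sub_self, zero_add, hm]
  have hev : ∀ᶠ s in nhdsWithin (0 : ℝ) (Set.Ioi 0), φ s < 0 ∧ s ∈ Set.Ioc (0 : ℝ) (1 / 2) :=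
    (((hφ.tendsto 0).eventually_lt_const hφ0).filter_mono nhdsWithin_le_nhds).and
      (Ioc_mem_nhdsGT (by norm_num))
  obtain ⟨s, hs, hs0, hs1⟩ := hev.exists
  have hmem : x + s • (y - x) ∈ interiorProfiles S := by
    refine ⟨convex_mixedProfiles.add_smul_sub_mem hx hy.1 ⟨hs0.le, by linarith⟩, fun k i => ?_⟩
    have h1 := (hx k).1 i
    have h2 := hy.2 k i
    simp only [Pi.add_apply, Pi.smul_apply, Pi.sub_apply, smul_eq_mul]
    nlinarith
  have h1 := logitGap_segment_le (G := G) hG.1 hT hx hmem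
  have h2 : G.logitGap w T x ≤ G.logitGap w T (x + s • (y - x)) := hmin hmem.1
  have h3 : G.weightedPayoff w y (y - x) =
      -∑ k, w k * (T k * ∑ i, (y k i - x k i) * Real.log (y k i)) := by
    have e1 := weightedPayoff_sub_eq (G := G) (w := w) hT x hy.1 hx
    have e2 := G.weightedPayoff_add_right w y x (y - x)
    rw [add_sub_cancel, hG.weightedPayoff_self hy.1] at e2
    rw [hG.weightedPayoff_self hx, ← hydef] at e1
    linarith
  have h4 : ∑ k, w k * (T k * ∑ i, (y k i - x k i) * Real.log ((x + s • (y - x)) k i))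
      - ∑ k, w k * (T k * ∑ i, (y k i - x k i) * Real.log (y k i)) ≤ m := by
    simp only [m, ← Finset.sum_sub_distrib, ← mul_sub]
    refine Finset.sum_le_sum fun k _ => mul_le_mul_of_nonneg_left
      (mul_le_mul_of_nonneg_left (Finset.sum_le_sum fun i _ => ?_) (hT k).le) (hG.1 k).le
    exact sub_mul_log_segment_le ((hx k).1 i) (hy.2 k i) hs0 hs1
  have h5 : G.weightedPayoff w (G.logitResponse T (x + s • (y - x))) (y - x)
        + ∑ k, w k * (T k * ∑ i, (y k i - x k i) * Real.log ((x + s • (y - x)) k i)) < 0 := by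
    simp only [φ] at hs
    linarith
  nlinarith [mul_neg_of_pos_of_neg hs0 h5]

theorem exists_isQRE [∀ k, Nonempty (S k)] (hG : G.IsRescaledZeroSum w) (hT : ∀ k, 0 < T k) :
    ∃ p, G.IsQRE T p := by
  obtain ⟨p, hp, hmin⟩ := isCompact_mixedProfiles.exists_isMinOn nonempty_mixedProfiles
    (continuous_logitGap (G := G) w T).continuousOn
  have h := logitResponse_eq_of_isMinOn hG hT hp hmin
  exact ⟨p, hp, fun k i => congrFun (congrFun h.symm k) i⟩

/-! ### The dissipation identity and uniqueness -/

theorem IsQRE.logitResponse_eq {p : ∀ k, S k → ℝ} (hp : G.IsQRE T p) :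
    G.logitResponse T p = p :=
  funext fun k => funext fun i => (hp.2 k i).symm

theorem IsQRE.mem_interiorProfiles [∀ k, Nonempty (S k)] {p : ∀ k, S k → ℝ}
    (hp : G.IsQRE T p) : p ∈ interiorProfiles S :=
  hp.logitResponse_eq ▸ G.logitResponse_mem T p

/-- Quantal response equilibria are rest points: there `r_{ki} - T_k ln p_{ki}` does not depend
on `i`. -/
theorem IsQRE.qField_eq_zero [∀ k, Nonempty (S k)] (hT : ∀ k, 0 < T k) {p : ∀ k, S k → ℝ}
    (hp : G.IsQRE T p) : G.qField T p = 0 := by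
  funext k i
  have h j : T k * Real.log (p k j) =
      G.reward p k j - T k * Real.log (∑ j, Real.exp (G.reward p k j / T k)) := by
    have := mul_log_logitResponse (G := G) hT p k j
    rwa [hp.logitResponse_eq] at this
  have h2 : T k * ∑ j, p k j * Real.log (p k j) = ∑ j, p k j * G.reward p k j
      - T k * Real.log (∑ j, Real.exp (G.reward p k j / T k)) := by
    rw [Finset.mul_sum]
    simp only [mul_left_comm (T k), h, mul_sub, Finset.sum_sub_distrib]
    rw [← Finset.sum_mul, (hp.1 k).2, one_mul]
  simp only [qField, Pi.zero_apply]
  rw [mul_sub (T k), h, h2]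
  ring

/-- The dissipation identity: the orbital derivative of the weighted divergence from an
equilibrium is minus the weighted symmetrised divergence. The payoffs contribute
`B(x - p, x - p)`, which is `0`. -/
theorem IsQRE.sum_qField_div [∀ k, Nonempty (S k)] (hG : G.IsRescaledZeroSum w)
    (hT : ∀ k, 0 < T k) {p x : ∀ k, S k → ℝ} (hp : G.IsQRE T p)
    (hx : x ∈ interiorProfiles S) :
    ∑ k, w k * ∑ i, p k i * -(G.qField T x k i / x k i) =
      -∑ k, w k * T k * (klVec (p k) (x k) + klVec (x k) (p k)) := by
  have hpi := hp.mem_interiorProfiles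
  have e1 k : ∑ i, p k i * -(G.qField T x k i / x k i) =
      ∑ i, x k i * G.reward x k i - ∑ i, p k i * G.reward x k i
      + T k * ∑ i, (p k i - x k i) * Real.log (x k i) := by
    have h i : p k i * -(G.qField T x k i / x k i) =
        p k i * (∑ j, x k j * G.reward x k j - T k * ∑ j, x k j * Real.log (x k j))
          - p k i * G.reward x k i + T k * (p k i * Real.log (x k i)) := by
      rw [qField, mul_div_cancel_left₀ _ (hx.2 k i).ne']
      ring
    simp only [h, Finset.sum_add_distrib, Finset.sum_sub_distrib, ← Finset.sum_mul,
      ← Finset.mul_sum, (hp.1 k).2, sub_mul]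
    ring
  have e2 := weightedPayoff_sub_eq (G := G) (w := w) hT p hp.1 hx.1
  rw [hp.logitResponse_eq, hG.weightedPayoff_self hp.1] at e2
  have e3 := hG.weightedPayoff_skew hp.1 hx.1
  have e4 := hG.weightedPayoff_self hx.1
  have e5 : ∑ k, w k * ∑ i, p k i * -(G.qField T x k i / x k i) =
      G.weightedPayoff w x x - G.weightedPayoff w p x
        + ∑ k, w k * (T k * ∑ i, (p k i - x k i) * Real.log (x k i)) := by
    simp only [e1, weightedPayoff, ← Finset.sum_add_distrib, ← Finset.sum_sub_distrib]
    refine Finset.sum_congr rfl fun k _ => ?_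
    rw [Finset.sum_sub_distrib, mul_add, mul_sub]
  have e6 : ∑ k, w k * T k * (klVec (p k) (x k) + klVec (x k) (p k)) =
      ∑ k, w k * (T k * ∑ i, (p k i - x k i) * Real.log (p k i))
        - ∑ k, w k * (T k * ∑ i, (p k i - x k i) * Real.log (x k i)) := by
    rw [← Finset.sum_sub_distrib]
    refine Finset.sum_congr rfl fun k _ => ?_
    rw [klVec_add_klVec_symm (hpi.2 k) (hx.2 k)]
    simp only [mul_sub, Finset.sum_sub_distrib]
    ring
  rw [e5, e6]
  linarith

/-- The weighted divergence dominates each player's divergence. -/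
theorem mul_klVec_le_klWeighted (hw : ∀ k, 0 < w k) {p x : ∀ k, S k → ℝ}
    (hp : p ∈ mixedProfiles S) (hx : x ∈ interiorProfiles S) (k : V) :
    w k * klVec (p k) (x k) ≤ klWeighted w p x :=
  Finset.single_le_sum (f := fun k => w k * klVec (p k) (x k))
    (fun k _ => mul_nonneg (hw k).le (klVec_nonneg (hp k) (hx.1 k) (hx.2 k)))
    (Finset.mem_univ k)

theorem klWeighted_pos (hw : ∀ k, 0 < w k) {p x : ∀ k, S k → ℝ}
    (hp : p ∈ mixedProfiles S) (hx : x ∈ interiorProfiles S) (hne : x ≠ p) :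
    0 < klWeighted w p x := by
  obtain ⟨k, hk⟩ := Function.ne_iff.1 hne
  exact (mul_pos (hw k) (klVec_pos (hp k) (hx.1 k) (hx.2 k) hk.symm)).trans_le
    (mul_klVec_le_klWeighted hw hp hx k)

theorem klWeighted_nonneg (hw : ∀ k, 0 < w k) {p x : ∀ k, S k → ℝ}
    (hp : p ∈ mixedProfiles S) (hx : x ∈ interiorProfiles S) : 0 ≤ klWeighted w p x :=
  Finset.sum_nonneg fun k _ => mul_nonneg (hw k).le (klVec_nonneg (hp k) (hx.1 k) (hx.2 k))

theorem klWeighted_self {p : ∀ k, S k → ℝ} (hp : p ∈ interiorProfiles S) :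
    klWeighted w p p = 0 :=
  Finset.sum_eq_zero fun k _ => by rw [klVec_self (hp.2 k), mul_zero]

/-- The dissipation rate of the weighted divergence is at least `min_k T_k` times the divergence:
the reversed divergences `D_KL(x_k ‖ p_k)` are nonnegative. -/
theorem iInf_mul_klWeighted_le (hw : ∀ k, 0 < w k) (hT : ∀ k, 0 < T k) {p x : ∀ k, S k → ℝ}
    (hp : p ∈ interiorProfiles S) (hx : x ∈ interiorProfiles S) :
    (⨅ k, T k) * klWeighted w p x ≤
      ∑ k, w k * T k * (klVec (p k) (x k) + klVec (x k) (p k)) := by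
  rw [klWeighted, Finset.mul_sum]
  refine Finset.sum_le_sum fun k _ => ?_
  have h1 := klVec_nonneg (hp.1 k) (hx.1 k) (hx.2 k)
  have h2 := klVec_nonneg (hx.1 k) (hp.1 k) (hp.2 k)
  have h3 : ⨅ k, T k ≤ T k := ciInf_le (Set.finite_range T).bddBelow k
  calc (⨅ k, T k) * (w k * klVec (p k) (x k)) ≤ T k * (w k * klVec (p k) (x k)) :=
        mul_le_mul_of_nonneg_right h3 (mul_nonneg (hw k).le h1)
    _ = w k * T k * klVec (p k) (x k) := by ring
    _ ≤ _ := mul_le_mul_of_nonneg_left (by linarith) (mul_pos (hw k) (hT k)).le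

theorem dissipation_pos (hw : ∀ k, 0 < w k) (hT : ∀ k, 0 < T k) {p x : ∀ k, S k → ℝ}
    (hp : p ∈ interiorProfiles S) (hx : x ∈ interiorProfiles S) (hne : x ≠ p) :
    0 < ∑ k, w k * T k * (klVec (p k) (x k) + klVec (x k) (p k)) := by
  obtain ⟨k, -⟩ := Function.ne_iff.1 hne
  have : Nonempty V := ⟨k⟩
  obtain ⟨k₀, hk₀⟩ := exists_eq_ciInf_of_finite (f := T)
  exact (mul_pos (hk₀ ▸ hT k₀) (klWeighted_pos hw hp.1 hx hne)).trans_le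
    (iInf_mul_klWeighted_le hw hT hp hx)

theorem existsUnique_isQRE [∀ k, Nonempty (S k)] (hG : G.IsRescaledZeroSum w)
    (hT : ∀ k, 0 < T k) : ∃! p, G.IsQRE T p := by
  obtain ⟨p, hp⟩ := exists_isQRE hG hT
  refine ⟨p, hp, fun q hq => ?_⟩
  by_contra hne
  -- the field vanishes at `q`, hence so does the dissipation at `q` relative to `p`
  have h1 := hp.sum_qField_div hG hT hq.mem_interiorProfiles
  have h2 := dissipation_pos hG.1 hT hp.mem_interiorProfiles hq.mem_interiorProfiles hne
  simp only [hq.qField_eq_zero hT, Pi.zero_apply, zero_div, neg_zero, mul_zero,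
    Finset.sum_const_zero] at h1
  linarith

/-! ### The Lyapunov function -/

theorem hasFDerivAt_klWeighted (w : V → ℝ) {p x : ∀ k, S k → ℝ} (hp : ∀ k i, 0 < p k i)
    (hx : ∀ k i, 0 < x k i) :
    ∃ L : (∀ k, S k → ℝ) →L[ℝ] ℝ, HasFDerivAt (fun x => klWeighted w p x) L x ∧
      ∀ v, L v = ∑ k, w k * ∑ i, p k i * -(v k i / x k i) := by
  let π k (i : S k) : (∀ k, S k → ℝ) →L[ℝ] ℝ :=
    (ContinuousLinearMap.proj (R := ℝ) (φ := fun _ : S k => ℝ) i).comp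
      (ContinuousLinearMap.proj (R := ℝ) (φ := fun k => S k → ℝ) k)
  have h k (i : S k) : HasFDerivAt (fun x : ∀ k, S k → ℝ => Real.log (p k i / x k i))
      (-(x k i)⁻¹ • π k i) x := by
    have h1 : HasDerivAt (fun b => Real.log (p k i / b)) (-(x k i)⁻¹) (x k i) := by
      have h2 := ((hasDerivAt_inv (hx k i).ne').const_mul (p k i)).log
        (mul_pos (hp k i) (inv_pos.2 (hx k i))).ne'
      refine h2.congr_deriv ?_
      have := (hx k i).ne'
      have := (hp k i).ne'
      field_simp
    exact h1.comp_hasFDerivAt x (π k i).hasFDerivAt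
  refine ⟨_, HasFDerivAt.fun_sum fun k _ => (HasFDerivAt.fun_sum fun i _ =>
    (h k i).const_mul (p k i)).const_mul (w k), fun v => ?_⟩
  simp only [sum_apply, smul_apply, smul_eq_mul]
  refine Finset.sum_congr rfl fun k _ => congrArg _ (Finset.sum_congr rfl fun i _ => ?_)
  simp only [π, ContinuousLinearMap.comp_apply, ContinuousLinearMap.proj_apply]
  ring

theorem IsQRE.isStrictLyapunov [∀ k, Nonempty (S k)] (hG : G.IsRescaledZeroSum w)
    (hT : ∀ k, 0 < T k) {p : ∀ k, S k → ℝ} (hp : G.IsQRE T p) :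
    IsStrictLyapunov (interiorProfiles S) (G.qField T) p (fun x => klWeighted w p x) where
  mem := hp.mem_interiorProfiles
  rest := hp.qField_eq_zero hT
  zero := klWeighted_self hp.mem_interiorProfiles
  pos x hx hne := klWeighted_pos hG.1 hp.1 hx hne
  diff x hx := by
    obtain ⟨L, hL, -⟩ := hasFDerivAt_klWeighted w hp.mem_interiorProfiles.2 hx.2
    exact hL.differentiableAt
  neg x hx hne := by
    obtain ⟨L, hL, hLv⟩ := hasFDerivAt_klWeighted w hp.mem_interiorProfiles.2 hx.2
    rw [hL.fderiv, hLv, hp.sum_qField_div hG hT hx]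
    exact neg_neg_of_pos (dissipation_pos hG.1 hT hp.mem_interiorProfiles hx hne)

/-! ### Trajectories -/

variable (G T) in
/-- A linear lower bound for the field: the only unbounded term `-T_k x_{ki} ln x_{ki}` is
nonnegative. -/
theorem exists_neg_mul_le_qField (hT : ∀ k, 0 < T k) (k : V) (i : S k) :
    ∃ M : ℝ, ∀ x ∈ mixedProfiles S, -M * x k i ≤ G.qField T x k i := by
  have hc : Continuous fun x : ∀ k, S k → ℝ => G.reward x k i - ∑ j, x k j * G.reward x k j
      + T k * ∑ j, x k j * Real.log (x k j) := by
    have h j : Continuous fun x : ∀ k, S k → ℝ => x k j * Real.log (x k j) :=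
      Real.continuous_mul_log.comp (by fun_prop : Continuous fun x : ∀ k, S k → ℝ => x k j)
    fun_prop
  obtain ⟨M, hM⟩ := isCompact_mixedProfiles.bddBelow_image hc.continuousOn
  refine ⟨-M, fun x hx => ?_⟩
  have h1 := hM (Set.mem_image_of_mem _ hx)
  have h2 := Real.log_nonpos ((hx k).1 i) (le_one_of_mem_stdSimplex (hx k) i)
  have h3 := (hx k).1 i
  rw [neg_neg, mul_comm, qField]
  refine mul_le_mul_of_nonneg_left ?_ h3
  nlinarith [mul_nonpos_of_nonneg_of_nonpos (hT k).le h2]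

/-- A differential inequality `u' ≥ -M u` on `[0, ∞)` integrates to `u(t) ≥ u(0) e^{-M t}`. -/
theorem mul_exp_le_of_neg_mul_le_deriv {u u' : ℝ → ℝ} {M : ℝ}
    (hu : ∀ t, 0 ≤ t → HasDerivWithinAt u (u' t) (Set.Ici 0) t)
    (hM : ∀ t, 0 ≤ t → -M * u t ≤ u' t) {t : ℝ} (ht : 0 ≤ t) :
    u 0 * Real.exp (-M * t) ≤ u t := by
  have hd s (hs : 0 ≤ s) : HasDerivWithinAt (fun s => u s * Real.exp (M * s))
      (u' s * Real.exp (M * s) + u s * (Real.exp (M * s) * M)) (Set.Ici 0) s := by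
    have h := ((hasDerivAt_id s).const_mul M).exp.hasDerivWithinAt (s := Set.Ici (0 : ℝ))
    simp only [id, mul_one] at h
    exact (hu s hs).mul h
  have hmono : MonotoneOn (fun s => u s * Real.exp (M * s)) (Set.Ici 0) := by
    refine monotoneOn_of_hasDerivWithinAt_nonneg (convex_Ici 0)
      (fun s hs => (hd s hs).continuousWithinAt)
      (fun s hs => (hd s (interior_subset hs)).mono interior_subset) fun s hs => ?_
    have := hM s (interior_subset hs)
    nlinarith [Real.exp_pos (M * s)]
  have h := hmono (Set.self_mem_Ici) ht ht
  simp only [mul_zero, Real.exp_zero, mul_one] at h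
  calc u 0 * Real.exp (-M * t) ≤ u t * Real.exp (M * t) * Real.exp (-M * t) :=
        mul_le_mul_of_nonneg_right h (Real.exp_pos _).le
    _ = u t := by rw [mul_assoc, ← Real.exp_add]; simp

theorem IsQTrajectory.mem_interiorProfiles (hT : ∀ k, 0 < T k) {x : ℝ → ∀ k, S k → ℝ}
    (hx : G.IsQTrajectory T x) (h0 : x 0 ∈ interiorProfiles S) {t : ℝ} (ht : 0 ≤ t) :
    x t ∈ interiorProfiles S := by
  refine ⟨(hx t ht).1, fun k i => ?_⟩
  obtain ⟨M, hM⟩ := exists_neg_mul_le_qField G T hT k i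
  refine (mul_pos (h0.2 k i) (Real.exp_pos (-M * t))).trans_le
    (mul_exp_le_of_neg_mul_le_deriv (u := fun s => x s k i)
      (u' := fun s => G.qField T (x s) k i) (fun s hs => ?_) (fun s hs => hM _ (hx s hs).1) ht)
  exact hasDerivWithinAt_pi.1 (hasDerivWithinAt_pi.1 (hx s hs).2 k) i

theorem IsQTrajectory.hasDerivWithinAt_klWeighted [∀ k, Nonempty (S k)]
    (hG : G.IsRescaledZeroSum w) (hT : ∀ k, 0 < T k) {p : ∀ k, S k → ℝ} (hp : G.IsQRE T p)
    {x : ℝ → ∀ k, S k → ℝ} (hx : G.IsQTrajectory T x) (h0 : x 0 ∈ interiorProfiles S) {t : ℝ}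
    (ht : 0 ≤ t) :
    HasDerivWithinAt (fun s => klWeighted w p (x s))
      (-∑ k, w k * T k * (klVec (p k) (x t k) + klVec (x t k) (p k))) (Set.Ici 0) t := by
  have hxt := hx.mem_interiorProfiles hT h0 ht
  obtain ⟨L, hL, hLv⟩ := hasFDerivAt_klWeighted w hp.mem_interiorProfiles.2 hxt.2
  rw [← hp.sum_qField_div hG hT hxt, ← hLv]
  exact hL.comp_hasDerivWithinAt t (hx t ht).2

theorem IsQTrajectory.klWeighted_le [∀ k, Nonempty (S k)]
    (hG : G.IsRescaledZeroSum w) (hT : ∀ k, 0 < T k) {p : ∀ k, S k → ℝ} (hp : G.IsQRE T p)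
    {x : ℝ → ∀ k, S k → ℝ} (hx : G.IsQTrajectory T x) (h0 : x 0 ∈ interiorProfiles S) {t : ℝ}
    (ht : 0 ≤ t) :
    klWeighted w p (x t) ≤ klWeighted w p (x 0) * Real.exp (-(⨅ k, T k) * t) := by
  have h := mul_exp_le_of_neg_mul_le_deriv (u := fun s => -klWeighted w p (x s)) (M := ⨅ k, T k)
    (fun s hs => (hx.hasDerivWithinAt_klWeighted hG hT hp h0 hs).neg) (fun s hs => ?_) ht
  · simp only [neg_mul] at h ⊢
    linarith
  · have := iInf_mul_klWeighted_le hG.1 hT hp.mem_interiorProfiles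
      (hx.mem_interiorProfiles hT h0 hs)
    linarith

theorem IsQTrajectory.norm_sub_le [∀ k, Nonempty (S k)]
    (hG : G.IsRescaledZeroSum w) (hT : ∀ k, 0 < T k) {p : ∀ k, S k → ℝ} (hp : G.IsQRE T p)
    {x : ℝ → ∀ k, S k → ℝ} (hx : G.IsQTrajectory T x) (h0 : x 0 ∈ interiorProfiles S) {t : ℝ}
    (ht : 0 ≤ t) :
    ‖x t - p‖ ≤ (∑ k, √(4 * klWeighted w p (x 0) / w k)) *
      Real.exp (-((⨅ k, T k) / 2) * t) := by
  have hxt := hx.mem_interiorProfiles hT h0 ht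
  have hC : 0 ≤ ∑ k, √(4 * klWeighted w p (x 0) / w k) :=
    Finset.sum_nonneg fun _ _ => Real.sqrt_nonneg _
  have hCe := mul_nonneg hC (Real.exp_pos (-((⨅ k, T k) / 2) * t)).le
  refine (pi_norm_le_iff_of_nonneg hCe).2 fun k => (pi_norm_le_iff_of_nonneg hCe).2 fun i => ?_
  have hwk := hG.1 k
  have h1 : (x t k i - p k i) ^ 2 ≤
      4 * klWeighted w p (x 0) / w k * Real.exp (-((⨅ k, T k) / 2) * t) ^ 2 := by
    have e1 := mul_le_mul_of_nonneg_left (sq_le_klVec (hp.1 k) (hxt.1 k) (hxt.2 k) i) hwk.le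
    have e2 := mul_klVec_le_klWeighted hG.1 hp.1 hxt k
    have e3 := hx.klWeighted_le hG hT hp h0 ht
    have e4 : Real.exp (-((⨅ k, T k) / 2) * t) ^ 2 = Real.exp (-(⨅ k, T k) * t) := by
      rw [← Real.exp_nat_mul]
      congr 1
      push_cast
      ring
    rw [e4, div_mul_eq_mul_div, le_div_iff₀ hwk]
    nlinarith
  have h2 : √(4 * klWeighted w p (x 0) / w k) ≤ ∑ k, √(4 * klWeighted w p (x 0) / w k) :=
    Finset.single_le_sum (f := fun k => √(4 * klWeighted w p (x 0) / w k))
      (fun _ _ => Real.sqrt_nonneg _) (Finset.mem_univ k)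
  refine le_trans ?_ (mul_le_mul_of_nonneg_right h2 (Real.exp_pos _).le)
  simp only [Pi.sub_apply, Real.norm_eq_abs]
  refine abs_le_of_sq_le_sq (h1.trans_eq ?_)
    (mul_nonneg (Real.sqrt_nonneg _) (Real.exp_pos _).le)
  rw [mul_pow, Real.sq_sqrt (div_nonneg
    (mul_nonneg (by norm_num) (klWeighted_nonneg hG.1 hp.1 h0)) hwk.le)]

end Game

end PolymatrixGame

theorem mainTheorem1 {V : Type*} [Fintype V] {S : V → Type*} [∀ k, Fintype (S k)]
    [∀ k, Nonempty (S k)] (G : PolymatrixGame V S) (w T : V → ℝ)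
    (hG : G.IsRescaledZeroSum w) (hT : ∀ k, 0 < T k) :
    (∃! p, G.IsQRE T p) ∧
    ∀ p, G.IsQRE T p →
      -- the weighted divergence is a strict Lyapunov function for `p`
      IsStrictLyapunov (PolymatrixGame.interiorProfiles S) (G.qField T) p
        (fun x => klWeighted w p x) ∧
      -- along every trajectory it has the stated derivative and decays exponentially
      (∀ x : ℝ → ∀ k, S k → ℝ, G.IsQTrajectory T x →
        x 0 ∈ PolymatrixGame.interiorProfiles S → ∀ t, 0 ≤ t →
          x t ∈ PolymatrixGame.interiorProfiles S ∧
          HasDerivWithinAt (fun s => klWeighted w p (x s))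
            (-∑ k, w k * T k * (klVec (p k) (x t k) + klVec (x t k) (p k))) (Set.Ici 0) t ∧
          klWeighted w p (x t) ≤ klWeighted w p (x 0) * Real.exp (-(⨅ k, T k) * t)) ∧
      -- trajectories converge to `p` exponentially fast
      (∃ c : ℝ, 0 < c ∧ ∀ x₀ ∈ PolymatrixGame.interiorProfiles S, ∃ C : ℝ,
        ∀ x : ℝ → ∀ k, S k → ℝ, G.IsQTrajectory T x → x 0 = x₀ →
          ∀ t, 0 ≤ t → ‖x t - p‖ ≤ C * Real.exp (-c * t)) := by
  refine ⟨PolymatrixGame.existsUnique_isQRE hG hT, fun p hp => ⟨hp.isStrictLyapunov hG hT,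
    fun x hx h0 t ht => ⟨hx.mem_interiorProfiles hT h0 ht,
      hx.hasDerivWithinAt_klWeighted hG hT hp h0 ht, hx.klWeighted_le hG hT hp h0 ht⟩, ?_⟩⟩
  rcases isEmpty_or_nonempty V with hV | hV
  · -- without players the space of profiles is a single point
    exact ⟨1, one_pos, fun _ _ => ⟨0, fun x _ _ t _ => by
      rw [Subsingleton.elim (x t) p, sub_self, norm_zero, zero_mul]⟩⟩
  · obtain ⟨k, hk⟩ := exists_eq_ciInf_of_finite (f := T)
    refine ⟨(⨅ k, T k) / 2, half_pos (hk ▸ hT k), fun x₀ hx₀ =>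
      ⟨∑ k, √(4 * klWeighted w p x₀ / w k), fun x hx h0 t ht => ?_⟩⟩
    subst h0
    exact hx.norm_sub_le hG hT hp hx₀ ht
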